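/- Let $I$ be a finite nonempty set and consider a Bayesian network with node set $I$: a directed acyclic graph with parent sets $\pi_i$, sample spaces $\mathcal X_i$ carrying pseudo-metrics $\rho_i$, parameter spaces $\Theta_i$, and, for each $\theta_i\in\Theta_i$, conditional probability densities $p_{\theta_i}(x_i\mid x_{\pi_i})$ (measurable in the parameter and in the observations). Put $\mathcal X=\prod_i\mathcal X_i$, $\Theta=\prod_i\Theta_i$, $p_\theta(x)=\prod_{i\in I}p_{\theta_i}(x_i\mid x_{\pi_i})$ and $\rho(x,y)=\sum_{i\in I}\rho_i(x_i,y_i)$. Let $\xi$ be a prior probability measure on $\Theta$ with marginals $\xi_i$ on $\Theta_i$, let $\phi(x)=\int_\Theta p_\theta(x)\,d\xi(\theta)$, and for $0<\phi(x)<\infty$ let $\xi(B\mid x)=\phi(x)^{-1}\int_B p_\theta(x)\,d\xi(\theta)$ be the posterior. Let $d(a,b)=|\ln(a/b)|$ for $a,b>0$, $d(0,0)=0$, and $d(a,0)=d(0,a)=\infty$ for $a>0$. For $i\in I$ and $L\ge 0$ let $$\Theta_{i,L}=\{\theta\in\Theta:\ d\big(p_{\theta_i}(x_i\mid x_{\pi_i}),p_{\theta_i}(y_i\mid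 y_{\pi_i})\big)\le L\,\rho_i(x_i,y_i)\ \text{ for all } x,y\in\mathcal X\}.$$ Call the posterior $(\epsilon,\delta')$-differentially private under $\rho'$ if $\xi(B\mid x)\le e^{\epsilon\rho'(x,y)}\xi(B\mid y)+\delta'\rho'(x,y)$ for all $x,y$ and all measurable $B\subseteq\Theta$. In the following, $x,y$ range over the points of $\mathcal X$ at which the posterior is defined, and $B$ over the measurable subsets of $\Theta$. 1. Suppose that there are $L_i\ge 0$ with $\Theta_{i,L_i}=\Theta$ for every $i\in I$, and let $\|L\|_\infty=\max_i L_i$. Then $$\xi(B\mid x)\le\exp\{2\|L\|_\infty\,\rho(x,y)\}\,\xi(B\mid y)\quad\text{for all }x,y,B,$$ i.e. the posterior is $(2\|L\|_\infty,0)$-differentially private under $\rho$. 2. Suppose that there are $L_0>0$ and numbers $c_i$ such that $\xi(\Theta_{i,L})\ge 1-e^{-c_iL}$ for all $i\in I$ and all $L\ge L_0$, that $c:=\min_i c_i-\ln|I|/L_0>0$, and that for some $\delta\in(0,1)$ we have $\rho(x,y)\le(1-\delta)c$ for all $x,y\in\mathcal X$. Suppose also that $\sup_{\theta_i\in\Theta_i}p_{\theta_i}(x_i\mid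 x_{\pi_i})<\infty$ for all $i$ and $x\in\mathcal X$ and that the constants $$C_i=\sup_{x\in\mathcal X}\frac{\sup_{\theta_i\in\Theta_i}p_{\theta_i}(x_i\mid x_{\pi_i})}{\int_{\Theta_i}p_{\theta_i}(x_i\mid x_{\pi_i})\,d\xi_i(\theta_i)}$$ are finite (with $0/0=0$). Let $C=\prod_{i\in I}C_i$, $\kappa=4.91081$, $\omega=1.25643$ and $$M=\left(\frac{\kappa}{c}+L_0\Big(\frac1{1-e^{-\omega}}+1\Big)+\ln C+\ln\Big(e^{-L_0\delta c}\big(e^{-\omega(1-\delta)}-e^{-\omega}\big)^{-1}+e^{L_0(1-\delta)c}\Big)\right)C .$$ Then $$\left|\xi(B\mid x)-\xi(B\mid y)\right|\le\sqrt{\tfrac M2\max\{\rho(x,y),1\}}\quad\text{for all }x,y,B,$$ i.e. on the pairs with $\rho(x,y)\ge 1$ the posterior is $\big(0,\sqrt{M/2}\big)$-differentially private under $\sqrt{\rho}$. 3. The constant satisfies $M=O\big((\tfrac1c+\ln C+L_0)\,C\big)$: for every $\delta\in(0,1)$ and $c_{\max}>0$ there is a constant $A$ such that $|M|\le A\,(\tfrac1c+\ln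 C+L_0)\,C$ for all $0<c\le c_{\max}$, $L_0>0$ and $C\ge1$, where $M$ is given by the formula above. -/

import Mathlib

open MeasureTheory
open scoped NNReal ENNReal

/-- The absolute log-ratio distance `|log (a / b)|` between two nonnegative numbers. It vanishes
when both numbers are zero and is infinite when exactly one of them is zero. -/
noncomputable def logRatioDist (a b : ℝ≥0) : ℝ≥0∞ :=
  if a = 0 ∧ b = 0 then 0
  else if a = 0 ∨ b = 0 then ⊤
  else ENNReal.ofReal |Real.log ((a : ℝ) / (b : ℝ))|

/-- A Bayesian network with nodes `I`, sample space `X i` and parameter space `Θ i` at node `i`: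
a directed acyclic graph, given by its parent sets, with a parametric family of conditional
probability densities at every node. The number `lik i t a u` is the conditional likelihood
(density with respect to the reference measure `base i`) of the value `a` of the `i`-th variable,
given that its parents take the values `u`, under the parameter `t`. -/
structure BayesNet (I : Type*) (X Θ : I → Type*)
    [∀ i, MeasurableSpace (X i)] [∀ i, MeasurableSpace (Θ i)] where
  parents : I → Set I
  acyclic : ∀ i, ¬ Relation.TransGen (fun j k => j ∈ parents k) i i
  base : ∀ i, Measure (X i)
  lik : ∀ i, Θ i → X i → (∀ j : parents i, X j) → ℝ≥0
  measurable_param : ∀ i a u, Measurable fun t => lik i t a u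
  measurable_obs : ∀ i t, Measurable fun q : X i × (∀ j : parents i, X j) => lik i t q.1 q.2
  lintegral_lik : ∀ i t u, ∫⁻ a, (lik i t a u : ℝ≥0∞) ∂(base i) = 1

namespace BayesNet

variable {I : Type*} {X Θ : I → Type*}
  [∀ i, MeasurableSpace (X i)] [∀ i, MeasurableSpace (Θ i)]

/-- The conditional likelihood of the `i`-th coordinate of `x` given the coordinates of `x` at the
parents of `i`, under the node parameter `t`. -/
def nodeLik (N : BayesNet I X Θ) (i : I) (t : Θ i) (x : ∀ i, X i) : ℝ≥0 :=
  N.lik i t (x i) (fun j => x j)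

/-- The joint likelihood of `x`: the product over the nodes of the conditional likelihoods. -/
def jointLik [Fintype I] (N : BayesNet I X Θ) (θ : ∀ i, Θ i) (x : ∀ i, X i) : ℝ≥0 :=
  ∏ i, N.nodeLik i (θ i) x

/-- The marginal likelihood `φ(x)` of an observation `x` under the prior `ξ`. -/
noncomputable def evidence [Fintype I] (N : BayesNet I X Θ) (ξ : Measure (∀ i, Θ i))
    (x : ∀ i, X i) : ℝ≥0∞ :=
  ∫⁻ θ, (N.jointLik θ x : ℝ≥0∞) ∂ξ

/-- The posterior given `x` is defined when the marginal likelihood is positive and finite. -/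
def PosteriorDefined [Fintype I] (N : BayesNet I X Θ) (ξ : Measure (∀ i, Θ i))
    (x : ∀ i, X i) : Prop :=
  0 < N.evidence ξ x ∧ N.evidence ξ x < ⊤

/-- The posterior `B ↦ (∫_B p_θ(x) dξ(θ)) / φ(x)`. -/
noncomputable def posterior [Fintype I] (N : BayesNet I X Θ) (ξ : Measure (∀ i, Θ i))
    (x : ∀ i, X i) : Measure (∀ i, Θ i) :=
  (N.evidence ξ x)⁻¹ • ξ.withDensity (fun θ => (N.jointLik θ x : ℝ≥0∞))

/-- The set of parameters for which the conditional likelihood at node `i` is Lipschitz with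
constant `K`, in the log-ratio distance, for the pseudo-metric of the sample space of node `i`. -/
def nodeLipschitzSet [∀ i, PseudoMetricSpace (X i)] (N : BayesNet I X Θ) (i : I) (K : ℝ) :
    Set (∀ i, Θ i) :=
  {θ | ∀ x y : ∀ i, X i,
    logRatioDist (N.nodeLik i (θ i) x) (N.nodeLik i (θ i) y)
      ≤ ENNReal.ofReal (K * dist (x i) (y i))}

/-- The maximum conditional likelihood at node `i`. -/
noncomputable def nodeMaxLik (N : BayesNet I X Θ) (i : I) (x : ∀ i, X i) : ℝ≥0∞ :=
  ⨆ t : Θ i, (N.nodeLik i t x : ℝ≥0∞)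

/-- The marginal conditional likelihood at node `i`: the integral of the conditional likelihood
against the marginal prior on the parameter of that node. -/
noncomputable def nodeMarginalLik (N : BayesNet I X Θ) (ξ : Measure (∀ i, Θ i)) (i : I)
    (x : ∀ i, X i) : ℝ≥0∞ :=
  ∫⁻ t, (N.nodeLik i t x : ℝ≥0∞) ∂(ξ.map (fun θ => θ i))

/-- The constant `C i`: the supremum over the observations of the ratio between the maximum and the
marginal likelihood at node `i`. -/
noncomputable def nodeRatio (N : BayesNet I X Θ) (ξ : Measure (∀ i, Θ i)) (i : I) : ℝ≥0∞ :=
  ⨆ x : ∀ i, X i, N.nodeMaxLik i x / N.nodeMarginalLik ξ i x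

/-- The constant `C`, the product of the `C i` (used only when all of them are finite). -/
noncomputable def netRatio [Fintype I] (N : BayesNet I X Θ) (ξ : Measure (∀ i, Θ i)) : ℝ :=
  ∏ i, (N.nodeRatio ξ i).toReal

end BayesNet

/-- The summed pseudo-metric `ρ(x, y) = ∑ i, ρ_i(x_i, y_i)`. -/
noncomputable def sumDist {I : Type*} [Fintype I] {X : I → Type*} [∀ i, PseudoMetricSpace (X i)]
    (x y : ∀ i, X i) : ℝ :=
  ∑ i, dist (x i) (y i)

/-- The constant `min_i c_i - log |I| / L₀` of the network. -/
noncomputable def netRate {I : Type*} [Fintype I] [Nonempty I] (c : I → ℝ) (L₀ : ℝ) : ℝ :=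
  Finset.univ.inf' Finset.univ_nonempty c - Real.log (Fintype.card I) / L₀

/-- The numeric constant `κ`. -/
noncomputable def kappaConst : ℝ := 4.91081

/-- The numeric constant `ω`. -/
noncomputable def omegaConst : ℝ := 1.25643

/-- The constant `M` as a function of `c`, `L₀`, `δ` and `C`. -/
noncomputable def privacyConst (c L₀ δ C : ℝ) : ℝ :=
  (kappaConst / c + L₀ * (1 / (1 - Real.exp (-omegaConst)) + 1) + Real.log C
    + Real.log (Real.exp (-(L₀ * δ * c))
        * (Real.exp (-(omegaConst * (1 - δ))) - Real.exp (-omegaConst))⁻¹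
      + Real.exp (L₀ * (1 - δ) * c))) * C

/-- A randomised mechanism, with law `P x` on input `x`, is `(ε, δ)`-differentially private under
the pseudo-metric `ρ`, for the pairs of inputs in the relation `R`, if
`P x B ≤ exp (ε ρ(x, y)) P y B + δ ρ(x, y)` for all measurable `B` and all such pairs. -/
def IsDPUnder {S Y : Type*} [MeasurableSpace Y] (P : S → Measure Y) (R : S → S → Prop)
    (ρ : S → S → ℝ) (ε δ : ℝ) : Prop :=
  ∀ x y, R x y → ∀ B : Set Y, MeasurableSet B →
    (P x).real B ≤ Real.exp (ε * ρ x y) * (P y).real B + δ * ρ x y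

/-! Claim 1 is pointwise. Multiplying the Lipschitz bounds over the nodes changes the joint
likelihood by a factor of at most `exp (‖L‖ * ρ)`; the integral over `B` and the evidence each cost
this factor once, hence the 2.

Claim 2 rests on an estimate linear in `ρ`. Let `h` be the sum over the nodes of the log-ratio
distances between the likelihoods of `x` and `y`. Each summand has an exponential tail, so `∫ h ≤
ρ(x, y) * W` with `W = L₀ + 1 / c` (`integral_le_of_exponential_tail`). If both posterior densities
with respect to the prior are at most `D`, then posterior probabilities differ by at most `D * ∫ h`
(`normalized_setIntegral_sub_le`).

Since the prior may correlate the nodes, `C` itself need not serve as `D`. Dividing each node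
likelihood by its maximum gives numbers in `[0, 1]`, whose product is at least one minus the sum of
the deficits. Integrating this needs only the marginals of the prior, and gives `D = 1 / (1 - log
C)` when `log C < 1` (`jointLik_le`).

Finally `M ≥ C * (2 * W + log C)` (`le_privacyConst`). If `M ≥ 2` the claimed bound exceeds 1. If `M
< 2`, then `log C < 1` and `D * W ≤ M / 2` (`inv_one_sub_log_mul_le`), and the linear estimate
implies the square-root one because the difference lies in `[0, 1]`. -/

/-! ### The log-ratio distance. -/

lemma logRatioDist_comm (a b : ℝ≥0) : logRatioDist a b = logRatioDist b a := by
  unfold logRatioDist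
  simp only [and_comm (a := a = 0), or_comm (a := a = 0)]
  rw [← abs_neg (Real.log ((a : ℝ) / b)), ← Real.log_inv, inv_div]

/-- A finite distance excludes that exactly one of the numbers is zero, so the logarithm can be
exponentiated or both sides vanish. -/
lemma le_exp_mul_of_logRatioDist_le {a b : ℝ≥0} {t : ℝ} (ht : 0 ≤ t)
    (h : logRatioDist a b ≤ ENNReal.ofReal t) : (a : ℝ) ≤ Real.exp t * b := by
  unfold logRatioDist at h
  split_ifs at h with h₁ h₂
  · simp [h₁.1, h₁.2]
  · simp at h
  · push Not at h₂
    have ha : (0 : ℝ) < a := NNReal.coe_pos.2 (pos_iff_ne_zero.2 h₂.1)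
    have hb : (0 : ℝ) < b := NNReal.coe_pos.2 (pos_iff_ne_zero.2 h₂.2)
    have h₃ := (le_abs_self _).trans ((ENNReal.ofReal_le_ofReal_iff ht).1 h)
    rwa [Real.log_le_iff_le_exp (div_pos ha hb), div_le_iff₀ hb] at h₃

lemma Measurable.logRatioDist {Ω : Type*} [MeasurableSpace Ω] {f g : Ω → ℝ≥0}
    (hf : Measurable f) (hg : Measurable g) : Measurable fun ω => logRatioDist (f ω) (g ω) := by
  have hf₀ : MeasurableSet {ω | f ω = 0} := hf (measurableSet_singleton 0)
  have hg₀ : MeasurableSet {ω | g ω = 0} := hg (measurableSet_singleton 0)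
  refine Measurable.ite (hf₀.inter hg₀) measurable_const
    (Measurable.ite (hf₀.union hg₀) measurable_const ?_)
  exact (Real.measurable_log.comp
    (hf.coe_nnreal_real.div hg.coe_nnreal_real)).abs.ennreal_ofReal

/-! ### Means of variables with exponential tails. -/

/-- A set whose measure is below every late value of a decaying exponential is null. -/
lemma measure_eq_zero_of_le_exp {Ω : Type*} [MeasurableSpace Ω] {μ : Measure Ω}
    [IsFiniteMeasure μ] {E : Set Ω} {c L₀ : ℝ} (hc : 0 < c)
    (h : ∀ K, L₀ ≤ K → μ.real E ≤ Real.exp (-(c * K))) : μ E = 0 := by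
  rw [← measureReal_eq_zero_iff]
  refine le_antisymm ?_ measureReal_nonneg
  have hlim : Filter.Tendsto (fun K : ℝ => Real.exp (-(c * K))) Filter.atTop (nhds 0) :=
    Real.tendsto_exp_neg_atTop_nhds_zero.comp (Filter.tendsto_id.const_mul_atTop hc)
  exact ge_of_tendsto hlim ((Filter.eventually_ge_atTop L₀).mono h)

/-- A variable with an exponential tail beyond `L₀`, in units of `r`, is integrable and has mean
at most `r * (L₀ + 1 / c)`. -/
lemma integral_le_of_exponential_tail {Ω : Type*} [MeasurableSpace Ω] {μ : Measure Ω}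
    [IsProbabilityMeasure μ] {f : Ω → ℝ≥0∞} (hf : Measurable f) {r c L₀ : ℝ} (hr : 0 ≤ r)
    (hc : 0 < c) (hL : 0 < L₀)
    (h : ∀ K, L₀ ≤ K → 1 - Real.exp (-(c * K)) ≤ μ.real {ω | f ω ≤ ENNReal.ofReal (K * r)}) :
    (∀ᵐ ω ∂μ, f ω ≠ ⊤) ∧ Integrable (fun ω => (f ω).toReal) μ ∧
      ∫ ω, (f ω).toReal ∂μ ≤ r * (L₀ + 1 / c) := by
  have htail : ∀ K, L₀ ≤ K → μ.real {ω | ENNReal.ofReal (K * r) < f ω} ≤ Real.exp (-(c * K)) := by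
    intro K hK
    have hs : MeasurableSet {ω | f ω ≤ ENNReal.ofReal (K * r)} := measurableSet_le hf measurable_const
    have h₁ := probReal_compl_eq_one_sub (μ := μ) hs
    have h₂ : {ω | f ω ≤ ENNReal.ofReal (K * r)}ᶜ = {ω | ENNReal.ofReal (K * r) < f ω} := by
      ext ω; simp
    rw [h₂] at h₁
    linarith [h K hK]
  have htop : ∀ᵐ ω ∂μ, f ω ≠ ⊤ := by
    refine measure_eq_zero_of_le_exp (L₀ := L₀) hc fun K hK => ?_
    refine (measureReal_mono ?_).trans (htail K hK)
    intro ω hω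
    simp only [ne_eq, Set.mem_compl_iff, Set.mem_ofPred_eq, not_not] at hω
    simp [hω]
  refine ⟨htop, ?_⟩
  -- At `r = 0` every threshold `K * r` is 0, so `f` vanishes almost everywhere; the rate `c / r`
  -- below makes sense only for `r > 0`.
  rcases hr.eq_or_lt with rfl | hr
  · have h0 : ∀ᵐ ω ∂μ, (f ω).toReal = 0 := by
      refine measure_eq_zero_of_le_exp (L₀ := L₀) hc fun K hK => ?_
      refine (measureReal_mono ?_).trans (htail K hK)
      intro ω hω
      simp only [Set.mem_compl_iff, Set.mem_ofPred_eq, ENNReal.toReal_eq_zero_iff, not_or] at hω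
      simpa [pos_iff_ne_zero] using hω.1
    refine ⟨(integrable_congr h0).2 (integrable_zero _ _ _), ?_⟩
    rw [integral_congr_ae h0]
    simp
  set a : ℝ := c / r with ha
  have ha₀ : 0 < a := div_pos hc hr
  have hmain : ∫⁻ ω, ENNReal.ofReal (f ω).toReal ∂μ ≤ ENNReal.ofReal (r * (L₀ + 1 / c)) := by
    rw [lintegral_eq_lintegral_meas_lt μ (Filter.Eventually.of_forall fun ω => ENNReal.toReal_nonneg)
      hf.ennreal_toReal.aemeasurable]
    -- Layer-cake bound: the tail is at most 1 up to `L₀ * r` and decays at rate `c / r` beyond, so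
    -- the integrals of the two terms contribute `r * L₀` and `r / c`.
    have hpt : ∀ t ∈ Set.Ioi (0 : ℝ), μ {ω | t < (f ω).toReal} ≤
        (Set.Ioc 0 (L₀ * r)).indicator (1 : ℝ → ℝ≥0∞) t + ENNReal.ofReal (Real.exp (-a * t)) := by
      intro t ht
      by_cases hle : t ≤ L₀ * r
      · rw [Set.indicator_of_mem (show t ∈ Set.Ioc 0 (L₀ * r) from ⟨ht, hle⟩)]
        exact prob_le_one.trans le_self_add
      · rw [Set.indicator_of_notMem (fun h => hle h.2), zero_add]
        refine (ENNReal.le_ofReal_iff_toReal_le (measure_ne_top _ _) (Real.exp_pos _).le).2 ?_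
        have h₁ := htail (t / r) ((le_div_iff₀ hr).2 (not_le.1 hle).le)
        rw [div_mul_cancel₀ _ hr.ne'] at h₁
        have h₂ : -(c * (t / r)) = -a * t := by rw [ha]; ring
        rw [h₂] at h₁
        refine (measureReal_mono ?_).trans h₁
        intro ω hω
        exact (ENNReal.ofReal_lt_iff_lt_toReal (le_of_lt ht)
          (fun h => by simp [h] at hω; exact absurd hω (not_lt.2 (le_of_lt ht)))).2 hω
    calc _ ≤ ∫⁻ t in Set.Ioi (0 : ℝ), ((Set.Ioc 0 (L₀ * r)).indicator (1 : ℝ → ℝ≥0∞) t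
              + ENNReal.ofReal (Real.exp (-a * t))) := setLIntegral_mono' measurableSet_Ioi hpt
      _ = (∫⁻ t in Set.Ioi (0 : ℝ), (Set.Ioc 0 (L₀ * r)).indicator (1 : ℝ → ℝ≥0∞) t)
            + ∫⁻ t in Set.Ioi (0 : ℝ), ENNReal.ofReal (Real.exp (-a * t)) :=
          lintegral_add_left (measurable_one.indicator measurableSet_Ioc) _
      _ ≤ ENNReal.ofReal (L₀ * r) + ENNReal.ofReal (1 / a) := by
          gcongr
          · refine (setLIntegral_le_lintegral _ _).trans ?_
            rw [lintegral_indicator_one measurableSet_Ioc, Real.volume_Ioc, sub_zero]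
          · rw [← ofReal_integral_eq_lintegral_ofReal (integrableOn_exp_mul_Ioi (by linarith) 0)
              (Filter.Eventually.of_forall fun t => (Real.exp_pos _).le),
              integral_exp_mul_Ioi (by linarith)]
            simp
      _ = ENNReal.ofReal (r * (L₀ + 1 / c)) := by
          rw [← ENNReal.ofReal_add (by positivity) (by positivity), ha]
          congr 1
          field_simp
  have hmeas : Measurable fun ω => (f ω).toReal := hf.ennreal_toReal
  refine ⟨⟨hmeas.aestronglyMeasurable, ?_⟩, ?_⟩
  · rw [hasFiniteIntegral_iff_ofReal (Filter.Eventually.of_forall fun ω => ENNReal.toReal_nonneg)]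
    exact hmain.trans_lt ENNReal.ofReal_lt_top
  · rw [integral_eq_lintegral_of_nonneg_ae
      (Filter.Eventually.of_forall fun ω => ENNReal.toReal_nonneg) hmeas.aestronglyMeasurable]
    exact ENNReal.toReal_le_of_le_ofReal (by positivity) hmain

/-! ### Comparison of normalised densities. -/

/-- Two probability densities bounded by `D` whose unnormalised versions have log-ratio at most `h`
differ by at most `D * ∫ h` on every event. -/
lemma normalized_setIntegral_sub_le {Ω : Type*} [MeasurableSpace Ω] {μ : Measure Ω}
    {p q h : Ω → ℝ} {D : ℝ} (hp : Integrable p μ) (hq : Integrable q μ) (hh : Integrable h μ)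
    (hp₀ : ∀ ω, 0 ≤ p ω) (hq₀ : ∀ ω, 0 ≤ q ω) (hh₀ : ∀ ω, 0 ≤ h ω)
    (hpZ : 0 < ∫ ω, p ω ∂μ) (hqZ : 0 < ∫ ω, q ω ∂μ)
    (hpD : ∀ ω, p ω ≤ D * ∫ ω, p ω ∂μ) (hqD : ∀ ω, q ω ≤ D * ∫ ω, q ω ∂μ)
    (hpq : ∀ᵐ ω ∂μ, p ω ≤ Real.exp (h ω) * q ω) (hqp : ∀ᵐ ω ∂μ, q ω ≤ Real.exp (h ω) * p ω)
    {B : Set Ω} (hB : MeasurableSet B) :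
    (∫ ω in B, p ω ∂μ) / (∫ ω, p ω ∂μ) - (∫ ω in B, q ω ∂μ) / (∫ ω, q ω ∂μ)
      ≤ D * ∫ ω, h ω ∂μ := by
  -- From `exp (-h) ≥ 1 - h` one gets `g ≥ f - h * f`, and the bound on the density makes the loss
  -- at most `D * Z * h`.
  have key : ∀ {f g : Ω → ℝ} {Z : ℝ}, Integrable f μ → Integrable g μ → (∀ ω, 0 ≤ f ω) →
      (∀ ω, f ω ≤ D * Z) → (∀ᵐ ω ∂μ, f ω ≤ Real.exp (h ω) * g ω) → ∀ A : Set Ω,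
      ∫ ω in A, f ω ∂μ - D * Z * ∫ ω in A, h ω ∂μ ≤ ∫ ω in A, g ω ∂μ := by
    intro f g Z hf hg hf₀ hfD hfg A
    rw [← integral_const_mul, ← integral_sub hf.integrableOn (hh.integrableOn.const_mul _)]
    refine integral_mono_ae (hf.integrableOn.sub (hh.integrableOn.const_mul _)) hg.integrableOn ?_
    filter_upwards [ae_restrict_of_ae hfg] with ω hω
    have h₁ : (1 - h ω) * f ω ≤ Real.exp (-h ω) * f ω :=
      mul_le_mul_of_nonneg_right (by linarith [Real.add_one_le_exp (-h ω)]) (hf₀ ω)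
    have h₂ : Real.exp (-h ω) * f ω ≤ g ω := by
      have := mul_le_mul_of_nonneg_left hω (Real.exp_pos (-h ω)).le
      rwa [← mul_assoc, ← Real.exp_add, neg_add_cancel, Real.exp_zero, one_mul] at this
    have h₃ := mul_le_mul_of_nonneg_right (hfD ω) (hh₀ ω)
    linarith
  -- Using `p` against `q` on `B` and `q` against `p` on the complement makes the two losses add up
  -- to a single `D * ∫ h`, without a factor 2.
  have k₁ := key hp hq hp₀ hpD hpq B
  have k₂ := key hq hp hq₀ hqD hqp Bᶜ
  have sp := integral_add_compl hB hp
  have sq := integral_add_compl hB hq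
  have sh := integral_add_compl hB hh
  have np : 0 ≤ ∫ ω in B, p ω ∂μ := integral_nonneg hp₀
  have np' : 0 ≤ ∫ ω in Bᶜ, p ω ∂μ := integral_nonneg hp₀
  have nq : 0 ≤ ∫ ω in B, q ω ∂μ := integral_nonneg hq₀
  have nq' : 0 ≤ ∫ ω in Bᶜ, q ω ∂μ := integral_nonneg hq₀
  have nh : 0 ≤ ∫ ω in B, h ω ∂μ := integral_nonneg hh₀
  have nh' : 0 ≤ ∫ ω in Bᶜ, h ω ∂μ := integral_nonneg hh₀
  have hD : 0 ≤ D := by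
    by_contra hD
    push Not at hD
    have : ∫ ω, p ω ∂μ ≤ 0 := integral_nonpos fun ω =>
      (hpD ω).trans (mul_nonpos_of_nonpos_of_nonneg hD.le hpZ.le)
    linarith
  revert k₁ k₂ sp sq sh np np' nq nq' nh nh' hpZ hqZ
  generalize (∫ ω, p ω ∂μ) = Z, (∫ ω, q ω ∂μ) = W, (∫ ω, h ω ∂μ) = H,
    (∫ ω in B, p ω ∂μ) = p₁, (∫ ω in Bᶜ, p ω ∂μ) = p₂, (∫ ω in B, q ω ∂μ) = q₁,
    (∫ ω in Bᶜ, q ω ∂μ) = q₂, (∫ ω in B, h ω ∂μ) = h₁, (∫ ω in Bᶜ, h ω ∂μ) = h₂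
  rintro hZ hW k₁ k₂ rfl rfl rfl np np' nq nq' nh nh'
  rw [div_sub_div _ _ hZ.ne' hW.ne', div_le_iff₀ (mul_pos hZ hW)]
  have e : p₁ * (q₁ + q₂) - (p₁ + p₂) * q₁ = p₁ * q₂ - p₂ * q₁ := by ring
  rw [e]
  have hX : 0 ≤ D * (p₁ + p₂) * h₁ := by positivity
  have hY : 0 ≤ D * (q₁ + q₂) * h₂ := by positivity
  -- With losses `X` and `Y`, this follows from `q₁ * p₂ ≥ (p₁ - X) * (q₂ - Y)` when both factors
  -- are nonnegative; if one is not, a single term on the right already dominates `p₁ * q₂`.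
  have goal₁ : p₁ * q₂ - p₂ * q₁ ≤ D * (p₁ + p₂) * h₁ * q₂ + p₁ * (D * (q₁ + q₂) * h₂) := by
    generalize D * (p₁ + p₂) * h₁ = X at *
    generalize D * (q₁ + q₂) * h₂ = Y at *
    have := mul_nonneg np' nq
    rcases le_total p₁ X with h | h
    · nlinarith [mul_le_mul_of_nonneg_right h nq', mul_nonneg np hY]
    rcases le_total q₂ Y with h' | h'
    · nlinarith [mul_le_mul_of_nonneg_left h' np, mul_nonneg hX nq']
    · nlinarith [mul_le_mul k₁ k₂ (sub_nonneg.2 h') nq, mul_nonneg hX hY]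
  have a₁ : D * (p₁ + p₂) * h₁ * q₂ ≤ D * (p₁ + p₂) * h₁ * (q₁ + q₂) :=
    mul_le_mul_of_nonneg_left (by linarith) hX
  have a₂ : p₁ * (D * (q₁ + q₂) * h₂) ≤ (p₁ + p₂) * (D * (q₁ + q₂) * h₂) :=
    mul_le_mul_of_nonneg_right (by linarith) hY
  nlinarith

/-! ### Products in the unit interval, the summed metric and the rate. -/

/-- The union bound for products of numbers in the unit interval. -/
lemma one_sub_sum_one_sub_le_prod {ι : Type*} (s : Finset ι) {f : ι → ℝ} (h₀ : ∀ i, 0 ≤ f i)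
    (h₁ : ∀ i, f i ≤ 1) : 1 - ∑ i ∈ s, (1 - f i) ≤ ∏ i ∈ s, f i := by
  classical
  induction s using Finset.induction_on with
  | empty => simp
  | insert a s ha ih =>
    rw [Finset.sum_insert ha, Finset.prod_insert ha]
    have hP : ∏ i ∈ s, f i ≤ 1 := Finset.prod_le_one (fun i _ => h₀ i) fun i _ => h₁ i
    nlinarith [mul_nonneg (sub_nonneg.2 (h₁ a)) (sub_nonneg.2 hP)]

lemma sumDist_comm {I : Type*} [Fintype I] {X : I → Type*} [∀ i, PseudoMetricSpace (X i)]
    (x y : ∀ i, X i) : sumDist x y = sumDist y x := by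
  simp [sumDist, dist_comm]

lemma sumDist_nonneg {I : Type*} [Fintype I] {X : I → Type*} [∀ i, PseudoMetricSpace (X i)]
    (x y : ∀ i, X i) : 0 ≤ sumDist x y :=
  Finset.sum_nonneg fun _ _ => dist_nonneg

/-- The term `log |I| / L₀` only lowers the rate. Node means are added, so no union bound over the
nodes has to be paid for and each `c i` can simply be replaced by the common rate. -/
lemma netRate_le {I : Type*} [Fintype I] [Nonempty I] {c : I → ℝ} {L₀ : ℝ} (hL : 0 < L₀) (i : I) :
    netRate c L₀ ≤ c i := by
  have h₁ : Finset.univ.inf' Finset.univ_nonempty c ≤ c i := Finset.inf'_le _ (Finset.mem_univ i)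
  have h₂ : 0 ≤ Real.log (Fintype.card I) / L₀ :=
    div_nonneg (Real.log_natCast_nonneg _) hL.le
  unfold netRate
  linarith

/-! ### Joint likelihood, evidence and the density of the posterior. -/

namespace BayesNet

variable {I : Type*} {X Θ : I → Type*}
  [∀ i, MeasurableSpace (X i)] [∀ i, MeasurableSpace (Θ i)]

lemma measurable_nodeLik (N : BayesNet I X Θ) (i : I) (x : ∀ i, X i) :
    Measurable fun θ : ∀ i, Θ i => N.nodeLik i (θ i) x :=
  (N.measurable_param i (x i) _).comp (measurable_pi_apply i)

lemma nodeMarginalLik_eq (N : BayesNet I X Θ) (ξ : Measure (∀ i, Θ i)) (i : I) (x : ∀ i, X i) :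
    N.nodeMarginalLik ξ i x = ∫⁻ θ, (N.nodeLik i (θ i) x : ℝ≥0∞) ∂ξ :=
  lintegral_map (N.measurable_param i (x i) _).coe_nnreal_ennreal (measurable_pi_apply i)

variable [Fintype I]

lemma measurable_jointLik (N : BayesNet I X Θ) (x : ∀ i, X i) :
    Measurable fun θ => N.jointLik θ x :=
  Finset.measurable_prod _ fun i _ => N.measurable_nodeLik i x

lemma jointLik_le_exp_mul {N : BayesNet I X Θ} {θ : ∀ i, Θ i} {x y : ∀ i, X i} {t : I → ℝ}
    (ht : ∀ i, 0 ≤ t i)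
    (h : ∀ i, logRatioDist (N.nodeLik i (θ i) x) (N.nodeLik i (θ i) y) ≤ ENNReal.ofReal (t i)) :
    (N.jointLik θ x : ℝ) ≤ Real.exp (∑ i, t i) * N.jointLik θ y := by
  simp only [jointLik, NNReal.coe_prod]
  rw [Real.exp_sum, ← Finset.prod_mul_distrib]
  exact Finset.prod_le_prod (fun i _ => NNReal.coe_nonneg _) fun i _ =>
    le_exp_mul_of_logRatioDist_le (ht i) (h i)

lemma integral_jointLik (N : BayesNet I X Θ) (ξ : Measure (∀ i, Θ i)) (x : ∀ i, X i)
    (B : Set (∀ i, Θ i)) :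
    ∫ θ in B, (N.jointLik θ x : ℝ) ∂ξ = (∫⁻ θ in B, (N.jointLik θ x : ℝ≥0∞) ∂ξ).toReal := by
  rw [integral_eq_lintegral_of_nonneg_ae (Filter.Eventually.of_forall fun θ => NNReal.coe_nonneg _)
    (N.measurable_jointLik x).coe_nnreal_real.aestronglyMeasurable]
  simp

namespace PosteriorDefined

variable {N : BayesNet I X Θ} {ξ : Measure (∀ i, Θ i)} {x : ∀ i, X i}

lemma integrable (hx : N.PosteriorDefined ξ x) :
    Integrable (fun θ => (N.jointLik θ x : ℝ)) ξ := by
  refine ⟨(N.measurable_jointLik x).coe_nnreal_real.aestronglyMeasurable, ?_⟩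
  rw [hasFiniteIntegral_iff_ofReal (Filter.Eventually.of_forall fun θ => NNReal.coe_nonneg _)]
  simpa [evidence] using hx.2

lemma integral_eq (_ : N.PosteriorDefined ξ x) :
    ∫ θ, (N.jointLik θ x : ℝ) ∂ξ = (N.evidence ξ x).toReal := by
  simpa [evidence] using N.integral_jointLik ξ x Set.univ

lemma integral_pos (hx : N.PosteriorDefined ξ x) : 0 < ∫ θ, (N.jointLik θ x : ℝ) ∂ξ := by
  rw [hx.integral_eq]
  exact ENNReal.toReal_pos hx.1.ne' hx.2.ne

lemma posterior_real (hx : N.PosteriorDefined ξ x) {B : Set (∀ i, Θ i)} (hB : MeasurableSet B) :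
    (N.posterior ξ x).real B
      = (∫ θ in B, (N.jointLik θ x : ℝ) ∂ξ) / ∫ θ, (N.jointLik θ x : ℝ) ∂ξ := by
  rw [hx.integral_eq, N.integral_jointLik, Measure.real, posterior, Measure.smul_apply,
    withDensity_apply _ hB, smul_eq_mul, ENNReal.toReal_mul, ENNReal.toReal_inv, div_eq_inv_mul]

lemma posterior_real_le_one (hx : N.PosteriorDefined ξ x) {B : Set (∀ i, Θ i)}
    (hB : MeasurableSet B) : (N.posterior ξ x).real B ≤ 1 := by
  rw [hx.posterior_real hB, div_le_one hx.integral_pos]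
  exact setIntegral_le_integral hx.integrable
    (Filter.Eventually.of_forall fun θ => NNReal.coe_nonneg _)

/-- The `netRatio` constant is at least one, and the joint likelihood is dominated by the evidence
when its logarithm is below one. The prior need not be a product measure. -/
lemma jointLik_le [IsProbabilityMeasure ξ] (hx : N.PosteriorDefined ξ x)
    (hmax : ∀ i, N.nodeMaxLik i x ≠ ⊤) (hr : ∀ i, N.nodeRatio ξ i ≠ ⊤) :
    1 ≤ N.netRatio ξ ∧ (Real.log (N.netRatio ξ) < 1 →
      ∀ θ, (N.jointLik θ x : ℝ)
        ≤ (1 - Real.log (N.netRatio ξ))⁻¹ * ∫ θ, (N.jointLik θ x : ℝ) ∂ξ) := by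
  set S : I → ℝ := fun i => (N.nodeMaxLik i x).toReal with hS
  set C : I → ℝ := fun i => (N.nodeRatio ξ i).toReal with hC
  set m : I → ℝ := fun i => ∫ θ, (N.nodeLik i (θ i) x : ℝ) ∂ξ with hm
  have hle : ∀ i t, (N.nodeLik i t x : ℝ≥0∞) ≤ N.nodeMaxLik i x := fun i t =>
    le_iSup (fun t : Θ i => (N.nodeLik i t x : ℝ≥0∞)) t
  have hleS : ∀ i t, (N.nodeLik i t x : ℝ) ≤ S i := fun i t => by
    simpa using ENNReal.toReal_mono (hmax i) (hle i t)
  -- A vanishing node marginal would make the joint likelihood zero almost everywhere, against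
  -- positive evidence; so the convention `0 / 0 = 0` plays no role at such `x`.
  have hmarg₀ : ∀ i, N.nodeMarginalLik ξ i x ≠ 0 := by
    intro i h0
    rw [nodeMarginalLik_eq, lintegral_eq_zero_iff
      (N.measurable_nodeLik i x).coe_nnreal_ennreal] at h0
    refine hx.1.ne' ((lintegral_eq_zero_iff (N.measurable_jointLik x).coe_nnreal_ennreal).2 ?_)
    filter_upwards [h0] with θ hθ
    have h1 : N.nodeLik i (θ i) x = 0 := by simpa using hθ
    simpa [jointLik, Finset.prod_eq_zero_iff] using ⟨i, h1⟩
  have hmargle : ∀ i, N.nodeMarginalLik ξ i x ≤ N.nodeMaxLik i x := by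
    intro i
    rw [nodeMarginalLik_eq]
    refine (lintegral_mono fun θ : ∀ i, Θ i => hle i (θ i)).trans ?_
    simp
  have hmargtop : ∀ i, N.nodeMarginalLik ξ i x ≠ ⊤ := fun i =>
    ((hmargle i).trans_lt (hmax i).lt_top).ne
  have hmeq : ∀ i, m i = (N.nodeMarginalLik ξ i x).toReal := by
    intro i
    rw [nodeMarginalLik_eq, hm]
    simp only
    rw [integral_eq_lintegral_of_nonneg_ae
      (Filter.Eventually.of_forall fun θ => NNReal.coe_nonneg _)
      (N.measurable_nodeLik i x).coe_nnreal_real.aestronglyMeasurable]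
    simp
  have hmpos : ∀ i, 0 < m i := fun i => by
    rw [hmeq]; exact ENNReal.toReal_pos (hmarg₀ i) (hmargtop i)
  have hmS : ∀ i, m i ≤ S i := fun i => by
    rw [hmeq]; exact ENNReal.toReal_mono (hmax i) (hmargle i)
  have hSpos : ∀ i, 0 < S i := fun i => (hmpos i).trans_le (hmS i)
  have hSC : ∀ i, S i / m i ≤ C i := fun i => by
    rw [hmeq, hS, ← ENNReal.toReal_div]
    exact ENNReal.toReal_mono (hr i)
      (le_iSup (fun x => N.nodeMaxLik i x / N.nodeMarginalLik ξ i x) x)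
  have hC1 : ∀ i, 1 ≤ C i := fun i => ((one_le_div (hmpos i)).2 (hmS i)).trans (hSC i)
  have hnet : N.netRatio ξ = ∏ i, C i := rfl
  refine ⟨hnet ▸ Finset.one_le_prod fun i _ => hC1 i, fun hlt θ => ?_⟩
  have hlog : Real.log (N.netRatio ξ) = ∑ i, Real.log (C i) := by
    rw [hnet, Real.log_prod]
    exact fun i _ => (zero_lt_one.trans_le (hC1 i)).ne'
  -- The mean deficit at a node is at most `1 - 1 / C i ≤ log (C i)`; these logarithms sum to `log
  -- C`.
  have hnode : ∀ i, 1 - m i / S i ≤ Real.log (C i) := by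
    intro i
    have h₁ := Real.one_sub_inv_le_log_of_pos (zero_lt_one.trans_le (hC1 i))
    have h₂ : (C i)⁻¹ ≤ m i / S i := by
      rw [← inv_div]
      exact inv_anti₀ (div_pos (hSpos i) (hmpos i)) (hSC i)
    linarith
  have hint : ∀ i, Integrable (fun θ : ∀ i, Θ i => (N.nodeLik i (θ i) x : ℝ)) ξ := fun i =>
    Integrable.of_bound (N.measurable_nodeLik i x).coe_nnreal_real.aestronglyMeasurable (S i)
      (Filter.Eventually.of_forall fun θ => by simpa using hleS i (θ i))
  have hSprod : 0 < ∏ i, S i := Finset.prod_pos fun i _ => hSpos i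
  have hpt : ∀ θ, 1 - ∑ i, (1 - (N.nodeLik i (θ i) x : ℝ) / S i)
      ≤ (N.jointLik θ x : ℝ) / ∏ i, S i := by
    intro θ
    refine (one_sub_sum_one_sub_le_prod Finset.univ (fun i => div_nonneg (NNReal.coe_nonneg _)
      (hSpos i).le) fun i => (div_le_one (hSpos i)).2 (hleS i (θ i))).trans_eq ?_
    rw [Finset.prod_div_distrib, jointLik, NNReal.coe_prod]
  have hi : ∀ i, Integrable (fun θ : ∀ i, Θ i => 1 - (N.nodeLik i (θ i) x : ℝ) / S i) ξ :=
    fun i => (integrable_const _).sub ((hint i).div_const _)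
  have hmean := integral_mono
    ((integrable_const (1 : ℝ)).sub (integrable_finsetSum Finset.univ fun i _ => hi i))
    (hx.integrable.div_const _) hpt
  rw [integral_div, integral_sub' (integrable_const _)
    (integrable_finsetSum _ fun i _ => hi i), integral_finsetSum _ fun i _ => hi i] at hmean
  have hterm : ∀ i, ∫ θ, (1 - (N.nodeLik i (θ i) x : ℝ) / S i) ∂ξ = 1 - m i / S i := fun i => by
    rw [integral_sub (integrable_const _) ((hint i).div_const _), integral_div]
    simp [hm]
  simp only [hterm, integral_const, probReal_univ, smul_eq_mul, mul_one] at hmean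
  have hsum : ∑ i, (1 - m i / S i) ≤ Real.log (N.netRatio ξ) :=
    hlog ▸ Finset.sum_le_sum fun i _ => hnode i
  have hjoint : (N.jointLik θ x : ℝ) ≤ ∏ i, S i := by
    rw [jointLik, NNReal.coe_prod]
    exact Finset.prod_le_prod (fun i _ => NNReal.coe_nonneg _) fun i _ => hleS i (θ i)
  have hfin : 1 - Real.log (N.netRatio ξ) ≤ (∫ θ, (N.jointLik θ x : ℝ) ∂ξ) / ∏ i, S i := by
    linarith
  rw [le_div_iff₀ hSprod] at hfin
  rw [inv_mul_eq_div, le_div_iff₀ (by linarith)]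
  nlinarith

end PosteriorDefined

end BayesNet

/-! ### Estimates for the constant `M`. -/

lemma omegaConst_pos : 0 < omegaConst := by norm_num [omegaConst]

lemma exp_neg_omegaConst_sub_pos {δ : ℝ} (hδ : 0 < δ) :
    0 < (Real.exp (-(omegaConst * (1 - δ))) - Real.exp (-omegaConst))⁻¹ := by
  refine inv_pos.2 (sub_pos.2 (Real.exp_lt_exp.2 ?_))
  nlinarith [omegaConst_pos, mul_pos omegaConst_pos hδ]

lemma one_le_inv_one_sub_exp_neg_omegaConst : 1 ≤ 1 / (1 - Real.exp (-omegaConst)) := by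
  have h : Real.exp (-omegaConst) < 1 := by
    simpa using Real.exp_lt_exp.2 (neg_lt_zero.2 omegaConst_pos)
  rw [le_div_iff₀ (by linarith)]
  linarith [Real.exp_pos (-omegaConst)]

/-- The last logarithm in the constant `M` is nonnegative. -/
lemma privacyConst_log_nonneg {c L₀ δ : ℝ} (hc : 0 < c) (hL : 0 < L₀) (hδ : 0 < δ) (hδ' : δ < 1) :
    0 ≤ Real.log (Real.exp (-(L₀ * δ * c))
        * (Real.exp (-(omegaConst * (1 - δ))) - Real.exp (-omegaConst))⁻¹
      + Real.exp (L₀ * (1 - δ) * c)) := by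
  refine Real.log_nonneg ?_
  have h₁ := mul_pos (Real.exp_pos (-(L₀ * δ * c))) (exp_neg_omegaConst_sub_pos hδ)
  have h₂ : 1 ≤ Real.exp (L₀ * (1 - δ) * c) :=
    Real.one_le_exp (mul_nonneg (mul_nonneg hL.le (by linarith)) hc.le)
  linarith

/-- Three crude facts suffice: `κ ≥ 2`, `1 / (1 - exp (-ω)) ≥ 1`, and nonnegativity of the last
logarithm. -/
lemma le_privacyConst {c L₀ δ C : ℝ} (hc : 0 < c) (hL : 0 < L₀) (hδ : 0 < δ) (hδ' : δ < 1)
    (hC : 1 ≤ C) : C * (2 * (L₀ + 1 / c) + Real.log C) ≤ privacyConst c L₀ δ C := by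
  rw [privacyConst, mul_comm C]
  refine mul_le_mul_of_nonneg_right ?_ (by linarith)
  have h₁ := privacyConst_log_nonneg hc hL hδ hδ'
  have h₂ : 2 * (1 / c) ≤ kappaConst / c := by
    rw [mul_one_div]
    exact div_le_div_of_nonneg_right (by norm_num [kappaConst]) hc.le
  have h₃ := mul_le_mul_of_nonneg_left one_le_inv_one_sub_exp_neg_omegaConst hL.le
  linarith

/-- Both exponentials in the last logarithm are at most `exp (L₀ * c)`, so that logarithm is at most
`log (k + 1) + L₀ * c`, with `k` depending only on `δ`. Then `c ≤ cmax` lets `1 / c` absorb the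
constant and `L₀` absorb `L₀ * c`. -/
lemma privacyConst_isBigO {δ cmax : ℝ} (hδ : 0 < δ) (hδ' : δ < 1) (hcmax : 0 < cmax) :
    (fun q : ℝ × ℝ × ℝ => privacyConst q.1 q.2.1 δ q.2.2)
      =O[Filter.principal {q : ℝ × ℝ × ℝ | 0 < q.1 ∧ q.1 ≤ cmax ∧ 0 < q.2.1 ∧ 1 ≤ q.2.2}]
      (fun q : ℝ × ℝ × ℝ => (1 / q.1 + Real.log q.2.2 + q.2.1) * q.2.2) := by
  set k := (Real.exp (-(omegaConst * (1 - δ))) - Real.exp (-omegaConst))⁻¹ with hk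
  have hk₀ : 0 < k := exp_neg_omegaConst_sub_pos hδ
  set a := 1 / (1 - Real.exp (-omegaConst)) with ha
  have ha₁ : 1 ≤ a := one_le_inv_one_sub_exp_neg_omegaConst
  have hκ : (0 : ℝ) < kappaConst := by norm_num [kappaConst]
  have hlk : 0 ≤ Real.log (k + 1) := Real.log_nonneg (by linarith)
  refine Asymptotics.IsBigO.of_bound
    (kappaConst + (a + 1) + Real.log (k + 1) * cmax + cmax) ?_
  rw [Filter.eventually_principal]
  rintro ⟨c, L₀, C⟩ ⟨hc, hcm, hL, hC⟩
  simp only at hc hcm hL hC ⊢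
  have hlC : 0 ≤ Real.log C := Real.log_nonneg hC
  have hci : 0 < 1 / c := by positivity
  have hlog₀ := privacyConst_log_nonneg hc hL hδ hδ'
  have hM₀ : 0 ≤ privacyConst c L₀ δ C :=
    le_trans (by positivity) (le_privacyConst hc hL hδ hδ' hC)
  rw [Real.norm_of_nonneg hM₀, Real.norm_of_nonneg (by positivity), ← mul_assoc, privacyConst]
  refine mul_le_mul_of_nonneg_right ?_ (by linarith)
  have hlog : Real.log (Real.exp (-(L₀ * δ * c)) * k + Real.exp (L₀ * (1 - δ) * c))
      ≤ Real.log (k + 1) + L₀ * c := by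
    have h₁ : Real.exp (-(L₀ * δ * c)) ≤ Real.exp (L₀ * c) :=
      Real.exp_le_exp.2 (by nlinarith [mul_pos hL hc, mul_pos (mul_pos hL hδ) hc])
    have h₂ : Real.exp (L₀ * (1 - δ) * c) ≤ Real.exp (L₀ * c) :=
      Real.exp_le_exp.2 (by nlinarith [mul_pos (mul_pos hL hδ) hc])
    rw [← Real.log_exp (L₀ * c), ← Real.log_mul (by linarith) (Real.exp_pos _).ne']
    refine Real.log_le_log (by positivity) ?_
    nlinarith [mul_le_mul_of_nonneg_right h₁ hk₀.le]
  have e₁ : kappaConst / c = kappaConst * (1 / c) := by ring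
  have e₂ : Real.log (k + 1) ≤ Real.log (k + 1) * cmax * (1 / c) := by
    rw [mul_assoc]
    exact le_mul_of_one_le_right hlk (by rw [mul_one_div]; exact (one_le_div hc).2 hcm)
  have e₃ : L₀ * c ≤ cmax * L₀ := by rw [mul_comm]; exact mul_le_mul_of_nonneg_right hcm hL.le
  have p₁ : 0 ≤ (kappaConst + (a + 1) + Real.log (k + 1) * cmax + cmax - 1) * Real.log C :=
    mul_nonneg (by linarith [mul_nonneg hlk hcmax.le]) hlC
  have p₂ : 0 ≤ (a + 1 + cmax) * (1 / c) := by positivity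
  have p₃ : 0 ≤ (kappaConst + Real.log (k + 1) * cmax) * L₀ := by positivity
  rw [e₁]
  linarith

/-- The comparison behind the constant `M` for priors that need not be product measures. -/
lemma inv_one_sub_log_mul_le {C W : ℝ} (hC : 1 ≤ C) (hW : 0 ≤ W)
    (h : C * (2 * W + Real.log C) < 2) :
    Real.log C < 1 ∧ (1 - Real.log C)⁻¹ * W ≤ C * (2 * W + Real.log C) / 2 := by
  have hC₀ : 0 < C := by linarith
  have hs₀ : 0 ≤ Real.log C := Real.log_nonneg hC
  have hsC : Real.log C + 1 ≤ C := by
    simpa [Real.exp_log hC₀] using Real.add_one_le_exp (Real.log C)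
  -- If `log C ≥ 1` then `C ≥ log C + 1 ≥ 2`, so `C * log C ≥ 2`, against `h`.
  have hs₁ : Real.log C < 1 := by
    by_contra hs
    push Not at hs
    nlinarith [mul_nonneg hC₀.le hW]
  have hs₂ : C * (1 - Real.log C) ≤ 1 := by
    have := Real.one_sub_inv_le_log_of_pos hC₀
    have h' : 1 - Real.log C ≤ C⁻¹ := by linarith
    calc C * (1 - Real.log C) ≤ C * C⁻¹ := mul_le_mul_of_nonneg_left h' hC₀.le
      _ = 1 := mul_inv_cancel₀ hC₀.ne'
  refine ⟨hs₁, ?_⟩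
  generalize Real.log C = s at *
  rw [inv_mul_eq_div, div_le_iff₀ (by linarith)]
  -- The goal amounts to `(2 * W + s) * (1 - C * (1 - s)) ≤ s`. After multiplying by `C`, the
  -- hypothesis replaces `C * (2 * W + s)` by 2, leaving `2 ≤ C * (2 - s)`, which holds because `(1
  -- + s) * (2 - s) ≥ 2` on `[0, 1]`.
  have h₁ := mul_le_mul_of_nonneg_right h.le (sub_nonneg.2 hs₂)
  have h₂ : 2 ≤ C * (2 - s) := by nlinarith [mul_nonneg hs₀ (sub_nonneg.2 hs₁.le)]
  have h₃ : C * ((2 * W + s) * (1 - C * (1 - s))) ≤ C * s := by linarith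
  have h₄ := le_of_mul_le_mul_left h₃ hC₀
  linarith

/-! ### Privacy bounds for the posterior. -/

namespace BayesNet

variable {I : Type*} {X Θ : I → Type*} [Fintype I]
  [∀ i, MeasurableSpace (X i)] [∀ i, PseudoMetricSpace (X i)] [∀ i, MeasurableSpace (Θ i)]
  {N : BayesNet I X Θ} {ξ : Measure (∀ i, Θ i)}

/-- Under node-wise Lipschitz likelihoods, the posterior is differentially private. -/
lemma posterior_real_le {L : I → ℝ} (hL : ∀ i, 0 ≤ L i)
    (hLip : ∀ i θ, θ ∈ N.nodeLipschitzSet i (L i)) {x y : ∀ i, X i}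
    (hx : N.PosteriorDefined ξ x) (hy : N.PosteriorDefined ξ y) {B : Set (∀ i, Θ i)}
    (hB : MeasurableSet B) :
    (N.posterior ξ x).real B
      ≤ Real.exp (2 * ‖L‖ * sumDist x y) * (N.posterior ξ y).real B := by
  have hpt : ∀ (x y : ∀ i, X i) (θ : ∀ i, Θ i),
      (N.jointLik θ x : ℝ) ≤ Real.exp (‖L‖ * sumDist x y) * N.jointLik θ y := by
    intro x y θ
    refine (jointLik_le_exp_mul (t := fun i => L i * dist (x i) (y i))
      (fun i => mul_nonneg (hL i) dist_nonneg) fun i => hLip i θ x y).trans ?_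
    refine mul_le_mul_of_nonneg_right (Real.exp_le_exp.2 ?_) (NNReal.coe_nonneg _)
    rw [sumDist, Finset.mul_sum]
    refine Finset.sum_le_sum fun i _ => mul_le_mul_of_nonneg_right ?_ dist_nonneg
    exact (le_abs_self _).trans (norm_le_pi_norm L i)
  set E := Real.exp (‖L‖ * sumDist x y) with hE
  have hE₀ : 0 < E := Real.exp_pos _
  have h₁ : ∫ θ in B, (N.jointLik θ x : ℝ) ∂ξ ≤ E * ∫ θ in B, (N.jointLik θ y : ℝ) ∂ξ := by
    rw [← integral_const_mul]
    exact integral_mono hx.integrable.integrableOn (hy.integrable.integrableOn.const_mul _)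
      (hpt x y)
  have h₂ : ∫ θ, (N.jointLik θ y : ℝ) ∂ξ ≤ E * ∫ θ, (N.jointLik θ x : ℝ) ∂ξ := by
    rw [← integral_const_mul]
    refine integral_mono hy.integrable (hx.integrable.const_mul _) fun θ => ?_
    simpa [hE, sumDist_comm x y] using hpt y x θ
  have hB₀ : 0 ≤ ∫ θ in B, (N.jointLik θ y : ℝ) ∂ξ :=
    integral_nonneg fun θ => NNReal.coe_nonneg _
  have hE₂ : Real.exp (2 * ‖L‖ * sumDist x y) = E * E := by
    rw [hE, ← Real.exp_add]; congr 1; ring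
  rw [hx.posterior_real hB, hy.posterior_real hB, hE₂, ← mul_div_assoc,
    div_le_div_iff₀ hx.integral_pos hy.integral_pos]
  calc _ ≤ (E * ∫ θ in B, (N.jointLik θ y : ℝ) ∂ξ) * (E * ∫ θ, (N.jointLik θ x : ℝ) ∂ξ) :=
        mul_le_mul h₁ h₂ hy.integral_pos.le (mul_nonneg hE₀.le hB₀)
    _ = _ := by ring

/-- Under node-wise stochastic Lipschitz likelihoods, the posterior probabilities of an event
differ by at most a multiple of the distance of the observations. -/
lemma posterior_real_sub_le [Nonempty I] [IsProbabilityMeasure ξ] {c : I → ℝ} {L₀ : ℝ}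
    (hL : 0 < L₀) (hc : 0 < netRate c L₀)
    (hLip : ∀ i K, L₀ ≤ K → 1 - Real.exp (-(c i * K)) ≤ ξ.real (N.nodeLipschitzSet i K))
    (hmax : ∀ i x, N.nodeMaxLik i x ≠ ⊤) (hr : ∀ i, N.nodeRatio ξ i ≠ ⊤)
    (hlog : Real.log (N.netRatio ξ) < 1) {x y : ∀ i, X i}
    (hx : N.PosteriorDefined ξ x) (hy : N.PosteriorDefined ξ y) {B : Set (∀ i, Θ i)}
    (hB : MeasurableSet B) :
    (N.posterior ξ x).real B - (N.posterior ξ y).real B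
      ≤ (1 - Real.log (N.netRatio ξ))⁻¹ * (sumDist x y * (L₀ + 1 / netRate c L₀)) := by
  set f : I → (∀ i, Θ i) → ℝ≥0∞ := fun i θ =>
    logRatioDist (N.nodeLik i (θ i) x) (N.nodeLik i (θ i) y) with hf
  -- For the fixed pair `x`, `y`, the Lipschitz set with constant `K` lies in the event `f i ≤ K *
  -- dist (x i) (y i)`, so the prior's mass bound becomes a tail bound with `r = dist (x i) (y i)`.
  have htail : ∀ i, (∀ᵐ θ ∂ξ, f i θ ≠ ⊤) ∧ Integrable (fun θ => (f i θ).toReal) ξ ∧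
      ∫ θ, (f i θ).toReal ∂ξ ≤ dist (x i) (y i) * (L₀ + 1 / c i) := fun i =>
    integral_le_of_exponential_tail ((N.measurable_nodeLik i x).logRatioDist
      (N.measurable_nodeLik i y)) dist_nonneg (hc.trans_le (netRate_le hL i)) hL
      fun K hK => (hLip i K hK).trans (measureReal_mono fun θ hθ => hθ x y)
  have htop : ∀ᵐ θ ∂ξ, ∀ i, f i θ ≠ ⊤ := ae_all_iff.2 fun i => (htail i).1
  rw [hx.posterior_real hB, hy.posterior_real hB]
  refine (normalized_setIntegral_sub_le (h := fun θ => ∑ i, (f i θ).toReal)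
    (D := (1 - Real.log (N.netRatio ξ))⁻¹) hx.integrable hy.integrable
    (integrable_finsetSum _ fun i _ => (htail i).2.1) (fun θ => NNReal.coe_nonneg _)
    (fun θ => NNReal.coe_nonneg _) (fun θ => Finset.sum_nonneg fun i _ => ENNReal.toReal_nonneg)
    hx.integral_pos hy.integral_pos ((hx.jointLik_le (fun i => hmax i x) hr).2 hlog)
    ((hy.jointLik_le (fun i => hmax i y) hr).2 hlog) ?_ ?_ hB).trans ?_
  · filter_upwards [htop] with θ hθ
    exact jointLik_le_exp_mul (fun i => ENNReal.toReal_nonneg) fun i =>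
      (ENNReal.ofReal_toReal (hθ i)).ge
  · filter_upwards [htop] with θ hθ
    refine jointLik_le_exp_mul (fun i => ENNReal.toReal_nonneg) fun i => ?_
    rw [logRatioDist_comm]
    exact (ENNReal.ofReal_toReal (hθ i)).ge
  · refine mul_le_mul_of_nonneg_left ?_ (inv_nonneg.2 (by linarith))
    rw [integral_finsetSum _ fun i _ => (htail i).2.1, sumDist, Finset.sum_mul]
    refine Finset.sum_le_sum fun i _ => (htail i).2.2.trans ?_
    refine mul_le_mul_of_nonneg_left ?_ dist_nonneg
    have := one_div_le_one_div_of_le hc (netRate_le hL i)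
    linarith

/-- The bound with the constant `M`. It is immediate when `2 ≤ M`; otherwise the linear bound of
`posterior_real_sub_le` applies, and a number in the unit interval is at most the square root of
any of its upper bounds. -/
lemma abs_posterior_real_sub_le [Nonempty I] [IsProbabilityMeasure ξ] {c : I → ℝ} {L₀ δ : ℝ}
    (hL : 0 < L₀) (hc : 0 < netRate c L₀) (hδ : 0 < δ) (hδ' : δ < 1)
    (hLip : ∀ i K, L₀ ≤ K → 1 - Real.exp (-(c i * K)) ≤ ξ.real (N.nodeLipschitzSet i K))
    (hmax : ∀ i x, N.nodeMaxLik i x ≠ ⊤) (hr : ∀ i, N.nodeRatio ξ i ≠ ⊤) {x y : ∀ i, X i}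
    (hx : N.PosteriorDefined ξ x) (hy : N.PosteriorDefined ξ y) {B : Set (∀ i, Θ i)}
    (hB : MeasurableSet B) :
    |(N.posterior ξ x).real B - (N.posterior ξ y).real B|
      ≤ √(privacyConst (netRate c L₀) L₀ δ (N.netRatio ξ) / 2 * max (sumDist x y) 1) := by
  have hC := (hx.jointLik_le (fun i => hmax i x) hr).1
  have hM := le_privacyConst hc hL hδ hδ' hC
  set M := privacyConst (netRate c L₀) L₀ δ (N.netRatio ξ)
  set W := L₀ + 1 / netRate c L₀ with hW
  have hW₀ : 0 ≤ W := by positivity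
  have hone : |(N.posterior ξ x).real B - (N.posterior ξ y).real B| ≤ 1 :=
    abs_le.2 ⟨by linarith [hy.posterior_real_le_one hB,
        measureReal_nonneg (μ := N.posterior ξ x) (s := B)],
      by linarith [hx.posterior_real_le_one hB,
        measureReal_nonneg (μ := N.posterior ξ y) (s := B)]⟩
  have hm : 1 ≤ max (sumDist x y) 1 := le_max_right _ _
  refine Real.le_sqrt_of_sq_le ?_
  rcases le_or_gt 2 M with h2 | h2
  · calc _ ≤ (1 : ℝ) := pow_le_one₀ (abs_nonneg _) hone
      _ ≤ M / 2 * max (sumDist x y) 1 := by nlinarith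
  · obtain ⟨hlog, hDW⟩ := inv_one_sub_log_mul_le hC hW₀ (hM.trans_lt h2)
    have hlin : |(N.posterior ξ x).real B - (N.posterior ξ y).real B|
        ≤ (1 - Real.log (N.netRatio ξ))⁻¹ * (sumDist x y * W) := by
      refine abs_le.2 ⟨?_, posterior_real_sub_le hL hc hLip hmax hr hlog hx hy hB⟩
      have := posterior_real_sub_le hL hc hLip hmax hr hlog hy hx hB
      rw [sumDist_comm y x, ← hW] at this
      linarith
    have hDW₀ := mul_nonneg (inv_nonneg.2 (sub_nonneg.2 hlog.le)) hW₀
    calc _ ≤ |(N.posterior ξ x).real B - (N.posterior ξ y).real B| :=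
          pow_le_of_le_one (abs_nonneg _) hone two_ne_zero
      _ ≤ (1 - Real.log (N.netRatio ξ))⁻¹ * W * sumDist x y := hlin.trans_eq (by ring)
      _ ≤ M / 2 * max (sumDist x y) 1 :=
          mul_le_mul (by linarith) (le_max_left _ _) (sumDist_nonneg x y) (by linarith)

end BayesNet

theorem mainTheorem1 {I : Type*} [Fintype I] [Nonempty I] {X Θ : I → Type*}
    [∀ i, MeasurableSpace (X i)] [∀ i, PseudoMetricSpace (X i)] [∀ i, MeasurableSpace (Θ i)]
    (N : BayesNet I X Θ) (ξ : Measure (∀ i, Θ i)) [IsProbabilityMeasure ξ] :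
    -- node-wise Lipschitz conditional likelihoods
    (∀ L : I → ℝ, (∀ i, 0 ≤ L i) → (∀ i θ, θ ∈ N.nodeLipschitzSet i (L i)) →
      (∀ x y, N.PosteriorDefined ξ x → N.PosteriorDefined ξ y →
        ∀ B : Set (∀ i, Θ i), MeasurableSet B →
          (N.posterior ξ x).real B
            ≤ Real.exp (2 * ‖L‖ * sumDist x y) * (N.posterior ξ y).real B) ∧
      IsDPUnder (N.posterior ξ) (fun x y => N.PosteriorDefined ξ x ∧ N.PosteriorDefined ξ y)
        sumDist (2 * ‖L‖) 0) ∧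
    -- node-wise stochastic Lipschitz conditional likelihoods
    (∀ (c : I → ℝ) (L₀ δ : ℝ), 0 < L₀ → 0 < netRate c L₀ → 0 < δ → δ < 1 →
      (∀ i K, L₀ ≤ K → 1 - Real.exp (-(c i * K)) ≤ ξ.real (N.nodeLipschitzSet i K)) →
      (∀ x y : ∀ i, X i, sumDist x y ≤ (1 - δ) * netRate c L₀) →
      (∀ i x, N.nodeMaxLik i x ≠ ⊤) → (∀ i, N.nodeRatio ξ i ≠ ⊤) →
      (∀ x y, N.PosteriorDefined ξ x → N.PosteriorDefined ξ y →
        ∀ B : Set (∀ i, Θ i), MeasurableSet B →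
          |(N.posterior ξ x).real B - (N.posterior ξ y).real B|
            ≤ √(privacyConst (netRate c L₀) L₀ δ (N.netRatio ξ) / 2 * max (sumDist x y) 1)) ∧
      IsDPUnder (N.posterior ξ)
        (fun x y => N.PosteriorDefined ξ x ∧ N.PosteriorDefined ξ y ∧ 1 ≤ sumDist x y)
        (fun x y => √(sumDist x y)) 0
        (√(privacyConst (netRate c L₀) L₀ δ (N.netRatio ξ) / 2))) ∧
    -- the order of the constant, for fixed `δ` and bounded `c`
    (∀ δ cmax : ℝ, 0 < δ → δ < 1 → 0 < cmax →
      (fun q : ℝ × ℝ × ℝ => privacyConst q.1 q.2.1 δ q.2.2)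
        =O[Filter.principal {q : ℝ × ℝ × ℝ | 0 < q.1 ∧ q.1 ≤ cmax ∧ 0 < q.2.1 ∧ 1 ≤ q.2.2}]
        (fun q : ℝ × ℝ × ℝ => (1 / q.1 + Real.log q.2.2 + q.2.1) * q.2.2)) := by
  refine ⟨fun L hL hLip => ?_, fun c L₀ δ hL hc hδ hδ' hLip _ hmax hr => ?_,
    fun δ cmax hδ hδ' hcmax => privacyConst_isBigO hδ hδ' hcmax⟩
  · have hpriv := fun x y hx hy B hB =>
      BayesNet.posterior_real_le (ξ := ξ) hL hLip (x := x) (y := y) hx hy (B := B) hB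
    refine ⟨hpriv, fun x y hxy B hB => ?_⟩
    simpa using hpriv x y hxy.1 hxy.2 B hB
  · have hpriv := fun x y hx hy B hB =>
      BayesNet.abs_posterior_real_sub_le hL hc hδ hδ' hLip hmax hr (x := x) (y := y) hx hy
        (B := B) hB
    refine ⟨hpriv, fun x y hxy B hB => ?_⟩
    have h := (le_abs_self _).trans (hpriv x y hxy.1 hxy.2.1 B hB)
    -- For `ρ ≥ 1` the maximum is `ρ`, and the root splits into the privacy parameter times `√ρ`.
    rw [max_eq_left hxy.2.2, Real.sqrt_mul' _ (sumDist_nonneg x y)] at h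
    rw [zero_mul, Real.exp_zero, one_mul]
    linarith
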